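/- All graphs are finite and simple, and $\alpha(G)$ denotes the independence number of $G$. For integers $k>\ell\ge 0$, a graph $G$ is $(k,\ell)$-stable if $\alpha(G-S)\ge\alpha(G)-\ell$ for every $S\subseteq V(G)$ with $|S|=k$, where $G-S$ is the subgraph of $G$ induced on $V(G)\setminus S$. A $(k,\ell)$-stable graph $G$ on $n$ vertices is tight if $\alpha(G)=\left\lfloor\frac{n-k+1}{2}\right\rfloor+\ell$. For all nonnegative integers $k,\ell$ with $k\ge 3\ell+3$, every tight $(k,\ell)$-stable graph has at most $(k-3\ell-3)+2^{3(\ell+4)^2}$ vertices. In particular, for every integer $k\ge 6$, every tight $(k,1)$-stable graph has at most $k-6+2^{75}$ vertices. -/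

import Mathlib

/-- A finite graph `G` is `(k, ℓ)`-stable (for `k > ℓ ≥ 0`) if `α(G - S) ≥ α(G) - ℓ` for every set
`S` of exactly `k` vertices. The graph `G - S` is the subgraph of `G` induced on the vertices
outside `S`, and `α` is Mathlib's independence number. -/
def SimpleGraph.IsStable {V : Type*} (G : SimpleGraph V) (k ℓ : ℕ) : Prop :=
  ∀ S : Finset V, S.card = k →
    (G.indepNum : ℤ) - (ℓ : ℤ) ≤ ((G.induce {v : V | v ∉ S}).indepNum : ℤ)

/-- A `(k, ℓ)`-stable graph `G` on `n` vertices is tight if `α(G) = ⌊(n - k + 1) / 2⌋ + ℓ`.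
The quotient is division of integers by the positive number `2`, which rounds down. -/
def SimpleGraph.IsTightStable {V : Type*} [Fintype V] (G : SimpleGraph V) (k ℓ : ℕ) : Prop :=
  G.IsStable k ℓ ∧
    (G.indepNum : ℤ) = ((Fintype.card V : ℤ) - (k : ℤ) + 1) / 2 + (ℓ : ℤ)

/-! Deleting a vertex outside some maximum independent set preserves tightness and lowers `k` by
one, so the core case is `k = 3ℓ + 3`. There, discard edges until every remaining edge is critical;
an isolated vertex can be removed at the cost of lowering `ℓ`. Otherwise let `I` be a maximum
independent set and `C` its complement. Tightness gives `d = |C| - |I| ≤ ℓ + 3`, so it remains to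
bound `|I|`.

At most `ℓ` vertices of `I` have degree at most two: deleting the closed neighbourhoods of `ℓ + 1`
of them removes at most `3ℓ + 3` vertices, and all `ℓ + 1` can be added back to any independent set
that is left (`IsStableOn.card_le_of_degree_le_two`).

The vertices of `I` with three neighbours are bounded in terms of `d` (`card_three_neighbours_le`).
With generic weights on the edges, the kernel `K` of the `I × C` matrix has dimension at most `d`.
Edges inside `C` give linearly independent bilinear forms on `K`, so there are at most `d ^ 2` of
them, and every independent subset of `C` lies in one of at most `2 ^ d ^ 2` fixed independent sets.
A critical edge from `i ∈ I` to `C` gives a vector with independent support that the matrix sends to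
the unit vector at `i`. Three neighbours give three such vectors, whose differences lie in `K`.
Among vertices sharing the same three fixed sets, these differences are triangular for the pairwise
intersections of three linear orders (`card_le_cube_of_isTightAt`). Chains there have length at most
`d`, and any two vertices are ordered alike by two of the three orders, so each class has at most `d
^ 3` vertices. -/

open Finset

/-! ### Generic matrices and matchings -/

section GenericWeights

variable {V : Type*}

/-- The field of rational functions in one indeterminate for each ordered pair of vertices. -/
abbrev GenericField (V : Type*) : Type _ := FractionRing (MvPolynomial (V × V) ℚ)

open Classical in
/-- The adjacency matrix of `G` with independent indeterminates in place of the ones. -/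
noncomputable def SimpleGraph.genericMatrix (G : SimpleGraph V) :
    Matrix V V (GenericField V) := fun i c =>
  if G.Adj i c then algebraMap (MvPolynomial (V × V) ℚ) (GenericField V) (MvPolynomial.X (i, c))
  else 0

theorem SimpleGraph.genericMatrix_of_not_adj (G : SimpleGraph V) {i c : V} (h : ¬ G.Adj i c) :
    G.genericMatrix i c = 0 := by
  simp [genericMatrix, h]

theorem SimpleGraph.genericMatrix_ne_zero (G : SimpleGraph V) {i c : V} (h : G.Adj i c) :
    G.genericMatrix i c ≠ 0 := by
  simp [genericMatrix, h, MvPolynomial.X_ne_zero]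

/-- A square submatrix of the generic matrix that carries a perfect matching is nonsingular. -/
theorem SimpleGraph.det_genericMatrix_submatrix_ne_zero (G : SimpleGraph V) {ι : Type*}
    [Fintype ι] [DecidableEq ι] {p q : ι → V} (hp : p.Injective) (hq : q.Injective)
    (hpq : ∀ t, G.Adj (p t) (q t)) :
    (G.genericMatrix.submatrix p q).det ≠ 0 := by
  classical
  obtain ⟨B, hBap⟩ : ∃ B : Matrix ι ι (MvPolynomial (V × V) ℚ), ∀ s t, B s t =
      if G.Adj (p s) (q t) then MvPolynomial.X (p s, q t) else 0 := ⟨Matrix.of _, fun _ _ => rfl⟩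
  have hB : G.genericMatrix.submatrix p q =
      (algebraMap (MvPolynomial (V × V) ℚ) (GenericField V)).mapMatrix B := by
    ext s t
    simp only [Matrix.submatrix_apply, genericMatrix, RingHom.mapMatrix_apply, Matrix.map_apply, hBap]
    split_ifs <;> simp
  rw [hB, ← RingHom.map_det]
  intro h0
  have hdet : B.det = 0 :=
    (map_eq_zero_iff _ (IsFractionRing.injective (MvPolynomial (V × V) ℚ) (GenericField V))).1 h0
  -- Specialising the matching indeterminates to 1 and the others to 0 turns the submatrix into the
  -- identity.
  let φ : MvPolynomial (V × V) ℚ →+* ℚ :=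
    MvPolynomial.eval fun e => if ∃ t, p t = e.1 ∧ q t = e.2 then 1 else 0
  have h1 : φ.mapMatrix B = 1 := by
    ext s t
    simp only [RingHom.mapMatrix_apply, Matrix.map_apply, hBap]
    by_cases hst : s = t
    · subst hst
      simp only [hpq s, if_true, φ, MvPolynomial.eval_X, Matrix.one_apply_eq]
      rw [if_pos ⟨s, rfl, rfl⟩]
    · rw [Matrix.one_apply_ne hst]
      split_ifs
      · simp only [φ, MvPolynomial.eval_X]
        rw [if_neg]
        rintro ⟨r, hr1, hr2⟩
        exact hst ((hp hr1).symm.trans (hq hr2))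
      · simp
  have := congrArg φ hdet
  rw [RingHom.map_det, h1] at this
  simp at this

/-- A vector supported on columns that are matched into rows annihilating it vanishes. -/
theorem SimpleGraph.eq_zero_of_genericMatrix_mulVec [Fintype V] (G : SimpleGraph V) {ι : Type*}
    [Fintype ι] {p q : ι → V} (hp : p.Injective) (hq : q.Injective)
    (hpq : ∀ t, G.Adj (p t) (q t)) {x : V → GenericField V}
    (hx : ∀ v, v ∉ Set.range q → x v = 0) (h0 : ∀ t, G.genericMatrix.mulVec x (p t) = 0) :
    x = 0 := by
  classical
  have h1 : (G.genericMatrix.submatrix p q).mulVec (x ∘ q) = 0 := by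
    ext t
    rw [Pi.zero_apply, ← h0 t]
    simp only [Matrix.mulVec, dotProduct, Matrix.submatrix_apply, Function.comp]
    rw [← Finset.sum_subset (Finset.subset_univ (univ.image q))]
    · rw [Finset.sum_image fun _ _ _ _ h => hq h]
    · intro v _ hv
      rw [hx v (by simpa using hv), mul_zero]
  have h2 := Matrix.eq_zero_of_mulVec_eq_zero
    (G.det_genericMatrix_submatrix_ne_zero hp hq hpq) h1
  ext v
  by_cases hv : v ∈ Set.range q
  · obtain ⟨t, rfl⟩ := hv
    exact congrFun h2 t
  · exact hx v hv

/-- More columns than rows leave a nontrivial vector annihilated by the rows. -/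
theorem Matrix.exists_ne_zero_support_subset_mulVec_eq_zero [Fintype V] {F : Type*} [Field F]
    (M : Matrix V V F) {S R : Finset V} (h : R.card < S.card) :
    ∃ x : V → F, x ≠ 0 ∧ (∀ v ∉ S, x v = 0) ∧ ∀ i ∈ R, M.mulVec x i = 0 := by
  classical
  let e : (S → F) →ₗ[F] (V → F) :=
    { toFun := fun y v => if hv : v ∈ S then y ⟨v, hv⟩ else 0
      map_add' := fun y z => by ext v; by_cases hv : v ∈ S <;> simp [hv]
      map_smul' := fun r y => by ext v; by_cases hv : v ∈ S <;> simp [hv] }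
  let f : (S → F) →ₗ[F] (R → F) := (LinearMap.funLeft F F Subtype.val) ∘ₗ M.mulVecLin ∘ₗ e
  have hker : LinearMap.ker f ≠ ⊥ := LinearMap.ker_ne_bot_of_finrank_lt (by simpa using h)
  obtain ⟨y, hy, hy0⟩ := (Submodule.ne_bot_iff _).1 hker
  refine ⟨e y, fun h0 => hy0 ?_, fun v hv => by simp [e, hv], fun i hi => ?_⟩
  · ext ⟨v, hv⟩
    simpa [e, hv] using congrFun h0 v
  · exact congrFun (LinearMap.mem_ker.1 hy) ⟨i, hi⟩

end GenericWeights

/-! ### Dimension bounds from triangular and diagonal families -/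

/-- Vectors that are triangular with respect to a strict partial order bound its height. -/
theorem exists_strictMono_rank_of_triangular {ι F K : Type*} [Field F] [AddCommGroup K]
    [Module F K] [FiniteDimensional F K] (Y : Finset ι) (R : ι → ι → Prop)
    (htrans : ∀ i j k, R i j → R j k → R i k) (y : ι → K) (φ : ι → K →ₗ[F] F)
    (hφ : ∀ j ∈ Y, φ j (y j) ≠ 0) (h0 : ∀ i ∈ Y, ∀ j ∈ Y, R i j → φ j (y i) = 0) :
    ∃ ρ : ι → ℕ, (∀ j ∈ Y, ρ j ∈ Finset.Icc 1 (Module.finrank F K)) ∧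
      ∀ i ∈ Y, ∀ j ∈ Y, R i j → ρ i < ρ j := by
  -- The rank of `j` is the dimension of the span of the vectors at or below `j`. It grows strictly
  -- because `φ j` kills everything strictly below `j` but not `y j`.
  let P : ι → Submodule F K := fun j => Submodule.span F (y '' {i | i ∈ Y ∧ (i = j ∨ R i j)})
  have hmem : ∀ j ∈ Y, y j ∈ P j := fun j hj =>
    Submodule.subset_span ⟨j, ⟨hj, Or.inl rfl⟩, rfl⟩
  refine ⟨fun j => Module.finrank F (P j), fun j hj => Finset.mem_Icc.2 ⟨?_, ?_⟩, ?_⟩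
  · rw [Nat.one_le_iff_ne_zero, Ne, Submodule.finrank_eq_zero]
    intro hb
    have h1 := hmem j hj
    rw [hb, Submodule.mem_bot] at h1
    exact hφ j hj (by rw [h1, map_zero])
  · exact Submodule.finrank_le _
  · intro i hi j hj hij
    refine Submodule.finrank_lt_finrank_of_lt (lt_of_le_of_ne ?_ ?_)
    · refine Submodule.span_mono (Set.image_mono ?_)
      rintro k ⟨hk, rfl | hki⟩
      · exact ⟨hk, Or.inr hij⟩
      · exact ⟨hk, Or.inr (htrans _ _ _ hki hij)⟩
    · intro he
      have h1 : y j ∈ P i := he ▸ hmem j hj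
      have h2 : P i ≤ LinearMap.ker (φ j) := by
        refine Submodule.span_le.2 ?_
        rintro _ ⟨k, ⟨hk, hki⟩, rfl⟩
        have hkj : R k j := by
          rcases hki with rfl | hki
          · exact hij
          · exact htrans _ _ _ hki hij
        exact h0 k hk j hj hkj
      exact hφ j hj (h2 h1)

/-- If, for any two of three linear orders on `Y`, there are vectors in a `d`-dimensional space
that are triangular with respect to the intersection of the two orders, then `Y` has at most
`d ^ 3` elements. -/
theorem card_le_cube_of_triangular {ι F K : Type*} [Field F] [AddCommGroup K]
    [Module F K] [FiniteDimensional F K] (Y : Finset ι) (g : Fin 3 → ι → ℕ)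
    (hg : ∀ s, (g s).Injective) (y : Fin 3 → Fin 3 → ι → K) (φ : Fin 3 → Fin 3 → ι → K →ₗ[F] F)
    (hφ : ∀ s t, s ≠ t → ∀ j ∈ Y, φ s t j (y s t j) ≠ 0)
    (h0 : ∀ s t, s ≠ t → ∀ i ∈ Y, ∀ j ∈ Y, g s i < g s j → g t i < g t j →
      φ s t j (y s t i) = 0) :
    Y.card ≤ Module.finrank F K ^ 3 := by
  have key : ∀ s t, s ≠ t → ∃ ρ : ι → ℕ,
      (∀ j ∈ Y, ρ j ∈ Finset.Icc 1 (Module.finrank F K)) ∧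
      ∀ i ∈ Y, ∀ j ∈ Y, (g s i < g s j ∧ g t i < g t j) → ρ i < ρ j := fun s t hst =>
    exists_strictMono_rank_of_triangular Y (fun i j => g s i < g s j ∧ g t i < g t j)
      (fun i j k h1 h2 => ⟨h1.1.trans h2.1, h1.2.trans h2.2⟩) (y s t) (φ s t) (hφ s t hst)
      (fun i hi j hj h => h0 s t hst i hi j hj h.1 h.2)
  obtain ⟨a, ha, ha'⟩ := key 0 1 (by decide)
  obtain ⟨b, hb, hb'⟩ := key 0 2 (by decide)
  obtain ⟨c, hc, hc'⟩ := key 1 2 (by decide)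
  have hcard := Finset.card_le_card_of_injOn (s := Y)
    (t := Finset.Icc 1 (Module.finrank F K) ×ˢ Finset.Icc 1 (Module.finrank F K) ×ˢ
      Finset.Icc 1 (Module.finrank F K)) (fun j => (a j, b j, c j))
    (fun j hj => by
      have hj' : j ∈ Y := hj
      simp only [Finset.coe_product, Set.mem_prod, Finset.mem_coe]
      exact ⟨ha j hj', hb j hj', hc j hj'⟩) (by
      intro i hi j hj hij
      simp only [Prod.mk.injEq] at hij
      by_contra hne
      have ea := ne_of_lt ∘ ha' i hi j hj
      have ea' := ne_of_gt ∘ ha' j hj i hi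
      have eb := ne_of_lt ∘ hb' i hi j hj
      have eb' := ne_of_gt ∘ hb' j hj i hi
      have ec := ne_of_lt ∘ hc' i hi j hj
      have ec' := ne_of_gt ∘ hc' j hj i hi
      simp only [hij.1, hij.2.1, hij.2.2, ne_eq, not_true, imp_false]
        at ea ea' eb eb' ec ec'
      -- Two of the three orders agree on the pair `i`, `j`, and the rank attached to these two
      -- separates it.
      rcases lt_or_gt_of_ne (fun h => hne (hg 0 h)) with h | h <;>
      rcases lt_or_gt_of_ne (fun h => hne (hg 1 h)) with h' | h' <;>
      rcases lt_or_gt_of_ne (fun h => hne (hg 2 h)) with h'' | h'' <;>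
      tauto)
  refine hcard.trans (le_of_eq ?_)
  simp only [Finset.card_product, Nat.card_Icc, Nat.add_sub_cancel]
  ring

theorem card_le_finrank_of_diagonal {ι F M : Type*} [Fintype ι] [Field F] [AddCommGroup M]
    [Module F M] [FiniteDimensional F M] (B : ι → M) (φ : ι → M →ₗ[F] F)
    (hne : ∀ e, φ e (B e) ≠ 0) (h0 : ∀ e e', e' ≠ e → φ e (B e') = 0) :
    Fintype.card ι ≤ Module.finrank F M := by
  refine LinearIndependent.fintype_card_le_finrank (R := F) (b := B) ?_
  rw [Fintype.linearIndependent_iff]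
  intro g hg e
  have h1 := congrArg (φ e) hg
  rw [map_sum, map_zero, Finset.sum_eq_single e] at h1
  · rw [map_smul, smul_eq_mul] at h1
    exact (mul_eq_zero.1 h1).resolve_right (hne e)
  · intro e' _ hee
    rw [map_smul, h0 e e' hee, smul_zero]
  · intro hn
    exact absurd (mem_univ e) hn

/-- Products of two linear forms on `K`, each of which is nonzero at a point where all the others
vanish, number at most the square of the dimension of `K`. -/
theorem card_le_finrank_sq_of_products {ι F K : Type*} [Fintype ι] [Field F] [AddCommGroup K]
    [Module F K] [FiniteDimensional F K] (p q : ι → K →ₗ[F] F) (x : ι → K)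
    (hne : ∀ e, p e (x e) * q e (x e) ≠ 0)
    (h0 : ∀ e e', e' ≠ e → p e' (x e) * q e' (x e) = 0) :
    Fintype.card ι ≤ Module.finrank F K ^ 2 := by
  -- The products become bilinear forms, tested at the diagonal points `(x e, x e)`.
  have h := card_le_finrank_of_diagonal (F := F) (M := K →ₗ[F] K →ₗ[F] F)
    (fun e => (LinearMap.mul F F).compl₁₂ (p e) (q e))
    (fun e => (LinearMap.applyₗ (x e)) ∘ₗ (LinearMap.applyₗ (x e))) hne h0
  rwa [Module.finrank_linearMap, Module.finrank_linearMap, Module.finrank_self, mul_one,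
    ← sq] at h

/-! ### Critical splits: Hall conditions and the generic kernel -/

section CriticalSplit

variable {V : Type*} [DecidableEq V] {G : SimpleGraph V} {I C : Finset V}

/-- No two vertices of the finite set `S` are adjacent. -/
def SimpleGraph.IndepFinset (G : SimpleGraph V) (S : Finset V) : Prop :=
  ∀ u ∈ S, ∀ v ∈ S, ¬ G.Adj u v

omit [DecidableEq V] in
theorem SimpleGraph.IndepFinset.mono {S T : Finset V} (h : G.IndepFinset T) (hST : S ⊆ T) :
    G.IndepFinset S := fun u hu v hv => h u (hST hu) v (hST hv)

open Classical in
/-- The vertices of `I` that have a neighbour in `S`. -/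
noncomputable def SimpleGraph.nbrIn (G : SimpleGraph V) (I S : Finset V) : Finset V :=
  I.filter fun i => ∃ c ∈ S, G.Adj c i

omit [DecidableEq V] in
theorem SimpleGraph.mem_nbrIn {S : Finset V} {i : V} :
    i ∈ G.nbrIn I S ↔ i ∈ I ∧ ∃ c ∈ S, G.Adj c i := by
  simp [nbrIn]

omit [DecidableEq V] in
theorem SimpleGraph.nbrIn_subset (G : SimpleGraph V) (I S : Finset V) : G.nbrIn I S ⊆ I :=
  fun _ hi => (mem_nbrIn.1 hi).1

omit [DecidableEq V] in
theorem SimpleGraph.nbrIn_mono {S T : Finset V} (hST : S ⊆ T) : G.nbrIn I S ⊆ G.nbrIn I T :=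
  fun _ hi => by
    obtain ⟨h1, c, hc, h2⟩ := mem_nbrIn.1 hi
    exact mem_nbrIn.2 ⟨h1, c, hST hc, h2⟩

/-- The edges of `G` lie in the disjoint union of `I` and `C`, the set `I` is a maximum independent
set, no vertex of `I` is isolated, and deleting any edge increases the independence number. -/
structure SimpleGraph.IsCriticalSplit (G : SimpleGraph V) (I C : Finset V) : Prop where
  disj : Disjoint I C
  indep : G.IndepFinset I
  mem : ∀ u v, G.Adj u v → u ∈ I ∪ C
  max : ∀ J ⊆ I ∪ C, G.IndepFinset J → J.card ≤ I.card
  nbr : ∀ i ∈ I, ∃ v, G.Adj i v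
  crit : ∀ u v, G.Adj u v → ∃ J ⊆ I ∪ C, J.card = I.card + 1 ∧ u ∈ J ∧ v ∈ J ∧
    ∀ x ∈ J, ∀ y ∈ J, G.Adj x y → (x = u ∧ y = v) ∨ (x = v ∧ y = u)

namespace SimpleGraph.IsCriticalSplit

theorem mem_right (h : G.IsCriticalSplit I C) {i c : V} (hi : i ∈ I) (hic : G.Adj i c) :
    c ∈ C := by
  rcases mem_union.1 (h.mem c i hic.symm) with hc | hc
  · exact absurd hic (h.indep i hi c hc)
  · exact hc

/-- Exchanging the neighbours of `S` in `I` for `S` gives an independent set, which cannot exceed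
`I`. This is Hall's condition for matching independent subsets of `C` into `I`. -/
theorem card_le_card_nbrIn (h : G.IsCriticalSplit I C) {S : Finset V} (hS : S ⊆ C)
    (hind : G.IndepFinset S) : S.card ≤ (G.nbrIn I S).card := by
  have hd : Disjoint S (I \ G.nbrIn I S) :=
    (h.disj.symm.mono_left hS).mono_right sdiff_subset
  have h1 := h.max (S ∪ (I \ G.nbrIn I S))
    (union_subset (hS.trans subset_union_right) (sdiff_subset.trans subset_union_left)) (by
      have key : ∀ u ∈ S, ∀ v ∈ I \ G.nbrIn I S, ¬ G.Adj u v := fun u hu v hv ha =>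
        (mem_sdiff.1 hv).2 (mem_nbrIn.2 ⟨(mem_sdiff.1 hv).1, u, hu, ha⟩)
      intro u hu v hv huv
      rcases mem_union.1 hu with hu | hu <;> rcases mem_union.1 hv with hv | hv
      · exact hind u hu v hv huv
      · exact key u hu v hv huv
      · exact key v hv u hu huv.symm
      · exact h.indep u (mem_sdiff.1 hu).1 v (mem_sdiff.1 hv).1 huv)
  rw [card_union_of_disjoint hd, card_sdiff_of_subset (nbrIn_subset _ _ _)] at h1
  have h2 := card_le_card (nbrIn_subset G I S)
  omega

/-- Hall's condition for matching `I` into `C`. If two vertices of a violating `X` share a neighbour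
`w`, take `J` critical for the edge from one of them to `w`; it misses the other, so induction
applies to `X ∩ J`. Exchanging `J ∩ N(X)` for `X` destroys the only edge of `J` and leaves an
independent set larger than `I`. -/
theorem card_le_card_nbrIn_left (h : G.IsCriticalSplit I C) {X : Finset V} (hX : X ⊆ I) :
    X.card ≤ (G.nbrIn C X).card := by
  induction X using Finset.strongInduction with
  | H X ih =>
    by_contra! hlt
    obtain ⟨x, hx, x', hx', hne, w, hxw, hxw'⟩ :
        ∃ x ∈ X, ∃ x' ∈ X, x ≠ x' ∧ ∃ w, G.Adj x w ∧ G.Adj x' w := by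
      by_contra! hcon
      choose! f hf using h.nbr
      refine hlt.not_ge (card_le_card_of_injOn f ?_ ?_)
      · intro x hx
        exact mem_nbrIn.2 ⟨h.mem_right (hX hx) (hf x (hX hx)), x, hx, hf x (hX hx)⟩
      · intro x hx x' hx' he
        by_contra hne
        exact hcon x hx x' hx' hne (f x) (hf x (hX hx)) (he ▸ hf x' (hX hx'))
    have hwC : w ∈ C := h.mem_right (hX hx) hxw
    have hwN : w ∈ G.nbrIn C X := mem_nbrIn.2 ⟨hwC, x, hx, hxw⟩
    obtain ⟨J, hJ, hJc, hxJ, hwJ, hJe⟩ := h.crit x w hxw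
    have hx'J : x' ∉ J := by
      intro hx'J
      rcases hJe x' hx'J w hwJ hxw' with ⟨h1, -⟩ | ⟨h1, -⟩
      · exact hne h1.symm
      · exact G.irrefl (h1 ▸ hxw')
    have hTX : X ∩ J ⊂ X := by
      refine ⟨inter_subset_left, fun hsub => hx'J (mem_inter.1 (hsub hx')).2⟩
    have hT := ih _ hTX (hTX.1.trans hX)
    have hNT : G.nbrIn C (X ∩ J) ⊆ G.nbrIn C X := nbrIn_mono inter_subset_left
    have hsub : J ∩ G.nbrIn C X ⊆ insert w (G.nbrIn C X \ G.nbrIn C (X ∩ J)) := by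
      intro z hz
      rw [mem_inter] at hz
      by_cases hzT : z ∈ G.nbrIn C (X ∩ J)
      · obtain ⟨hzC, t, ht, htz⟩ := mem_nbrIn.1 hzT
        rcases hJe t (mem_inter.1 ht).2 z hz.1 htz with ⟨-, h2⟩ | ⟨h1, h2⟩
        · exact mem_insert.2 (Or.inl h2)
        · exact absurd (h2 ▸ hzC) (Finset.disjoint_left.1 h.disj (hX hx))
      · exact mem_insert.2 (Or.inr (mem_sdiff.2 ⟨hz.2, hzT⟩))
    have c1 : (J ∩ G.nbrIn C X).card ≤
        (G.nbrIn C X).card - (G.nbrIn C (X ∩ J)).card + 1 := by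
      refine (card_le_card hsub).trans ((card_insert_le _ _).trans ?_)
      rw [card_sdiff_of_subset hNT]
    have hmax := h.max ((J \ G.nbrIn C X) ∪ X)
      (union_subset (sdiff_subset.trans hJ) (hX.trans subset_union_left)) (by
        have key : ∀ u ∈ X, ∀ v ∈ J \ G.nbrIn C X, ¬ G.Adj u v := fun u hu v hv ha =>
          (mem_sdiff.1 hv).2 (mem_nbrIn.2 ⟨h.mem_right (hX hu) ha, u, hu, ha⟩)
        intro u hu v hv huv
        rcases mem_union.1 hu with hu | hu <;> rcases mem_union.1 hv with hv | hv
        · rw [mem_sdiff] at hu hv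
          rcases hJe u hu.1 v hv.1 huv with ⟨-, h2⟩ | ⟨h1, -⟩
          · exact hv.2 (h2 ▸ hwN)
          · exact hu.2 (h1 ▸ hwN)
        · exact key v hv u hu huv.symm
        · exact key u hu v hv huv
        · exact h.indep u (hX hu) v (hX hv) huv)
    have hsup : (J \ G.nbrIn C X) ∪ (X \ J) ⊆ (J \ G.nbrIn C X) ∪ X :=
      union_subset_union_right sdiff_subset
    have hdis : Disjoint (J \ G.nbrIn C X) (X \ J) :=
      (disjoint_sdiff (s := J) (t := X)).mono_left sdiff_subset
    have c2 := card_le_card hsup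
    rw [card_union_of_disjoint hdis] at c2
    have c3 := card_sdiff_add_card_inter J (G.nbrIn C X)
    have c4 := card_sdiff_add_card_inter X J
    have c5 := card_le_card hNT
    omega

end SimpleGraph.IsCriticalSplit

variable [Fintype V]

/-- The vectors supported on `C` that are annihilated by the rows of the generic matrix in `I`. -/
noncomputable def SimpleGraph.genericKernel (G : SimpleGraph V) (I C : Finset V) :
    Submodule (GenericField V) (V → GenericField V) where
  carrier := {x | (∀ v ∉ C, x v = 0) ∧ ∀ i ∈ I, G.genericMatrix.mulVec x i = 0}
  add_mem' := by
    rintro x y ⟨hx1, hx2⟩ ⟨hy1, hy2⟩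
    refine ⟨fun v hv => by simp [hx1 v hv, hy1 v hv], fun i hi => ?_⟩
    rw [Matrix.mulVec_add, Pi.add_apply, hx2 i hi, hy2 i hi, add_zero]
  zero_mem' := by simp
  smul_mem' := by
    rintro r x ⟨hx1, hx2⟩
    refine ⟨fun v hv => by simp [hx1 v hv], fun i hi => ?_⟩
    rw [Matrix.mulVec_smul, Pi.smul_apply, hx2 i hi, smul_zero]

omit [DecidableEq V] in
theorem SimpleGraph.mem_genericKernel {x : V → GenericField V} :
    x ∈ G.genericKernel I C ↔ (∀ v ∉ C, x v = 0) ∧ ∀ i ∈ I, G.genericMatrix.mulVec x i = 0 :=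
  Iff.rfl

namespace SimpleGraph.IsCriticalSplit

/-- Hall's theorem matches `S` into `I`, and the matched square submatrix is nonsingular. -/
theorem eq_zero_of_support_subset (h : G.IsCriticalSplit I C) {S : Finset V} (hS : S ⊆ C)
    (hind : G.IndepFinset S) {x : V → GenericField V} (hx : ∀ v ∉ S, x v = 0)
    (h0 : ∀ i ∈ I, G.genericMatrix.mulVec x i = 0) : x = 0 := by
  classical
  obtain ⟨f, hf, hf'⟩ := (Finset.all_card_le_biUnion_card_iff_exists_injective
    (fun c : S => G.nbrIn I {c.1})).1 (by
      intro T
      have h1 := h.card_le_card_nbrIn (S := T.image Subtype.val)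
        (fun v hv => by
          obtain ⟨c, -, rfl⟩ := mem_image.1 hv
          exact hS c.2)
        (hind.mono fun v hv => by
          obtain ⟨c, -, rfl⟩ := mem_image.1 hv
          exact c.2)
      rw [card_image_of_injective _ Subtype.val_injective] at h1
      refine h1.trans (card_le_card fun i hi => ?_)
      obtain ⟨hi, c, hc, hci⟩ := mem_nbrIn.1 hi
      obtain ⟨b, hb, rfl⟩ := mem_image.1 hc
      exact mem_biUnion.2 ⟨b, hb, mem_nbrIn.2 ⟨hi, b.1, mem_singleton_self _, hci⟩⟩)
  refine G.eq_zero_of_genericMatrix_mulVec hf Subtype.val_injective (fun t => ?_)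
    (fun v hv => hx v fun hvS => hv ⟨⟨v, hvS⟩, rfl⟩) (fun t => h0 _ (mem_nbrIn.1 (hf' t)).1)
  obtain ⟨-, c, hc, hci⟩ := mem_nbrIn.1 (hf' t)
  rw [mem_singleton.1 hc] at hci
  exact hci.symm

/-- With `I` matched into `C`, a kernel vector is determined by its entries at the unmatched
vertices of `C`. -/
theorem finrank_genericKernel_le (h : G.IsCriticalSplit I C) :
    Module.finrank (GenericField V) (G.genericKernel I C) ≤ C.card - I.card := by
  classical
  obtain ⟨f, hf, hf'⟩ := (Finset.all_card_le_biUnion_card_iff_exists_injective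
    (fun i : I => G.nbrIn C {i.1})).1 (by
      intro T
      have h1 := h.card_le_card_nbrIn_left (X := T.image Subtype.val)
        (fun v hv => by
          obtain ⟨c, -, rfl⟩ := mem_image.1 hv
          exact c.2)
      rw [card_image_of_injective _ Subtype.val_injective] at h1
      refine h1.trans (card_le_card fun i hi => ?_)
      obtain ⟨hi, c, hc, hci⟩ := mem_nbrIn.1 hi
      obtain ⟨b, hb, rfl⟩ := mem_image.1 hc
      exact mem_biUnion.2 ⟨b, hb, mem_nbrIn.2 ⟨hi, b.1, mem_singleton_self _, hci⟩⟩)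
  have hadj : ∀ t : I, G.Adj t.1 (f t) := fun t => by
    obtain ⟨-, c, hc, hci⟩ := mem_nbrIn.1 (hf' t)
    rwa [mem_singleton.1 hc] at hci
  let res : G.genericKernel I C →ₗ[GenericField V]
      ((C \ univ.image f : Finset V) → GenericField V) :=
    (LinearMap.funLeft (GenericField V) (GenericField V) Subtype.val) ∘ₗ
      (G.genericKernel I C).subtype
  have hinj : Function.Injective res := by
    rw [← LinearMap.ker_eq_bot, Submodule.eq_bot_iff]
    rintro ⟨x, hx⟩ hres
    rw [LinearMap.mem_ker] at hres
    have hx' := mem_genericKernel.1 hx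
    refine Subtype.ext (G.eq_zero_of_genericMatrix_mulVec Subtype.val_injective hf hadj ?_
      fun t => hx'.2 _ t.2)
    intro v hv
    by_cases hvC : v ∈ C
    · exact congrFun hres ⟨v, mem_sdiff.2 ⟨hvC, by simpa using hv⟩⟩
    · exact hx'.1 v hvC
  have h1 := LinearMap.finrank_le_finrank_of_injective hinj
  rw [Module.finrank_fintype_fun_eq_card, Fintype.card_coe, card_sdiff_of_subset] at h1
  · rwa [card_image_of_injective _ hf, card_univ, Fintype.card_coe] at h1
  · intro v hv
    obtain ⟨t, -, rfl⟩ := mem_image.1 hv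
    exact (mem_nbrIn.1 (hf' t)).1

/-- For `J` critical for `cd`, the set `J ∩ C` has more vertices than neighbours in `I`, hence
supports a nonzero kernel vector. Removing `c` or `d` makes the support independent, so neither
entry can vanish. -/
theorem exists_mem_genericKernel_of_adj (h : G.IsCriticalSplit I C) {c d : V} (hc : c ∈ C)
    (hd : d ∈ C) (hcd : G.Adj c d) :
    ∃ x ∈ G.genericKernel I C, x c ≠ 0 ∧ x d ≠ 0 ∧
      ∀ u v, G.Adj u v → x u ≠ 0 → x v ≠ 0 → (u = c ∧ v = d) ∨ (u = d ∧ v = c) := by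
  classical
  obtain ⟨J, hJ, hJc, hcJ, hdJ, hJe⟩ := h.crit c d hcd
  have hnI : ∀ v ∈ C, v ∉ I := fun v hv hvI => Finset.disjoint_left.1 h.disj hvI hv
  have hdis : Disjoint (J ∩ I) (G.nbrIn I (J ∩ C)) := by
    rw [Finset.disjoint_left]
    intro i hi hi'
    obtain ⟨hiI, s, hs, hsi⟩ := mem_nbrIn.1 hi'
    rcases hJe s (mem_inter.1 hs).1 i (mem_inter.1 hi).1 hsi with ⟨-, h1⟩ | ⟨-, h1⟩
    · exact hnI d hd (h1 ▸ hiI)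
    · exact hnI c hc (h1 ▸ hiI)
  have c1 : (J ∩ I).card + (G.nbrIn I (J ∩ C)).card ≤ I.card := by
    rw [← card_union_of_disjoint hdis]
    exact card_le_card (union_subset inter_subset_right (nbrIn_subset _ _ _))
  have c2 : J.card ≤ (J ∩ I).card + (J ∩ C).card := by
    have : J = (J ∩ I) ∪ (J ∩ C) := by rw [← inter_union_distrib_left, inter_eq_left.2 hJ]
    rw [this]
    convert card_union_le _ _ using 3 <;> rw [← this]
  obtain ⟨x, hx0, hxS, hxR⟩ := G.genericMatrix.exists_ne_zero_support_subset_mulVec_eq_zero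
    (S := J ∩ C) (R := G.nbrIn I (J ∩ C)) (by omega)
  have hxI : ∀ i ∈ I, G.genericMatrix.mulVec x i = 0 := by
    intro i hi
    by_cases hin : i ∈ G.nbrIn I (J ∩ C)
    · exact hxR i hin
    · refine Finset.sum_eq_zero fun v _ => ?_
      change G.genericMatrix i v * x v = 0
      by_cases hv : v ∈ J ∩ C
      · rw [G.genericMatrix_of_not_adj, zero_mul]
        exact fun ha => hin (mem_nbrIn.2 ⟨hi, v, hv, ha.symm⟩)
      · rw [hxS v hv, mul_zero]
  have hne : ∀ a, (a = c ∨ a = d) → x a ≠ 0 := by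
    intro a ha hxa
    refine hx0 (h.eq_zero_of_support_subset (S := (J ∩ C).erase a)
      ((erase_subset _ _).trans inter_subset_right) ?_ ?_ hxI)
    · intro u hu v hv huv
      simp only [mem_erase, mem_inter] at hu hv
      rcases ha with rfl | rfl <;>
      rcases hJe u hu.2.1 v hv.2.1 huv with ⟨h1, h2⟩ | ⟨h1, h2⟩ <;>
      simp_all
    · intro v hv
      by_cases hva : v = a
      · rw [hva, hxa]
      · exact hxS v fun hv' => hv (mem_erase.2 ⟨hva, hv'⟩)
  refine ⟨x, mem_genericKernel.2 ⟨fun v hv => hxS v fun hv' => hv (mem_inter.1 hv').2, hxI⟩,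
    hne c (Or.inl rfl), hne d (Or.inr rfl), fun u v huv hu hv => ?_⟩
  have hu' : u ∈ J ∩ C := by_contra fun hn => hu (hxS u hn)
  have hv' : v ∈ J ∩ C := by_contra fun hn => hv (hxS v hn)
  exact hJe u (mem_inter.1 hu').1 v (mem_inter.1 hv').1 huv

/-- The edges inside `C`, each listed in one orientation, number at most the square of the
dimension of the generic kernel. -/
theorem card_edges_le (h : G.IsCriticalSplit I C) (D : Finset (V × V))
    (hD : ∀ e ∈ D, e.1 ∈ C ∧ e.2 ∈ C ∧ G.Adj e.1 e.2) (hDs : ∀ e ∈ D, e.swap ∉ D) :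
    D.card ≤ Module.finrank (GenericField V) (G.genericKernel I C) ^ 2 := by
  classical
  choose! z hzK hz1 hz2 hz using fun (e : V × V) (he : e ∈ D) =>
    h.exists_mem_genericKernel_of_adj (hD e he).1 (hD e he).2.1 (hD e he).2.2
  let ev : V → G.genericKernel I C →ₗ[GenericField V] GenericField V :=
    fun v => (LinearMap.proj v) ∘ₗ (G.genericKernel I C).subtype
  have h1 := card_le_finrank_sq_of_products (fun e : D => ev e.1.1) (fun e : D => ev e.1.2)
    (fun e => ⟨z e.1, hzK e.1 e.2⟩) (fun e => mul_ne_zero (hz1 e.1 e.2) (hz2 e.1 e.2)) (by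
      intro e e' hne
      by_contra hcon
      rcases hz e.1 e.2 e'.1.1 e'.1.2 (hD e'.1 e'.2).2.2 (left_ne_zero_of_mul hcon)
        (right_ne_zero_of_mul hcon) with ⟨h1, h2⟩ | ⟨h1, h2⟩
      · exact hne (Subtype.ext (Prod.ext h1 h2))
      · have : e'.1 = e.1.swap := Prod.ext h1 h2
        exact hDs e.1 e.2 (this ▸ e'.2))
  rwa [Fintype.card_coe] at h1

end SimpleGraph.IsCriticalSplit

end CriticalSplit

/-! ### Tight sets and vertices with three neighbours -/

section Tight

variable {V : Type*} [DecidableEq V] {G : SimpleGraph V} {I C U : Finset V}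

/-- A set `S ⊆ U` in which `c` is the only neighbour of `i` and which does not expand into `I`. -/
structure SimpleGraph.IsTightAt (G : SimpleGraph V) (I U : Finset V) (i c : V) (S : Finset V) :
    Prop where
  subset : S ⊆ U
  mem : c ∈ S
  eq : ∀ c' ∈ S, G.Adj i c' → c' = c
  card : (G.nbrIn I S).card ≤ S.card

namespace SimpleGraph.IsCriticalSplit

/-- Tight sets of minimum size are ordered by adjacency between them and the vertices of `I`. -/
theorem card_lt_card_of_isTightAt (h : G.IsCriticalSplit I C) (hU : U ⊆ C)
    (hUi : G.IndepFinset U) {i j c d : V} (hi : i ∈ I) (hj : j ∈ I) (hij : i ≠ j)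
    (hic : G.Adj i c) (hjd : G.Adj j d) {S T : Finset V}
    (hS : G.IsTightAt I U i c S) (hSm : ∀ S', G.IsTightAt I U i c S' → S.card ≤ S'.card)
    (hT : G.IsTightAt I U j d T) (hTm : ∀ T', G.IsTightAt I U j d T' → T.card ≤ T'.card)
    {b : V} (hb : b ∈ S) (hjb : G.Adj j b) : T.card < S.card := by
  have low : ∀ X ⊆ U, X.card ≤ (G.nbrIn I X).card := fun X hX =>
    h.card_le_card_nbrIn (hX.trans hU) (hUi.mono hX)
  have hun : G.nbrIn I (T ∪ S) ⊆ G.nbrIn I T ∪ G.nbrIn I S := by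
    intro v hv
    obtain ⟨hvI, a, ha, hav⟩ := mem_nbrIn.1 hv
    rcases mem_union.1 ha with ha | ha
    · exact mem_union_left _ (mem_nbrIn.2 ⟨hvI, a, ha, hav⟩)
    · exact mem_union_right _ (mem_nbrIn.2 ⟨hvI, a, ha, hav⟩)
  have hin : G.nbrIn I (T ∩ S) ⊆ G.nbrIn I T ∩ G.nbrIn I S :=
    subset_inter (nbrIn_mono inter_subset_left) (nbrIn_mono inter_subset_right)
  have e1 := card_union_add_card_inter T S
  have e2 := card_union_add_card_inter (G.nbrIn I T) (G.nbrIn I S)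
  have l1 := low (T ∪ S) (union_subset hT.subset hS.subset)
  have l2 := low (T ∩ S) (inter_subset_left.trans hT.subset)
  have u1 := card_le_card hun
  have u2 := card_le_card hin
  have s1 := hS.card
  have s2 := hT.card
  -- If `d ∉ S`, then `j` neighbours both `T` and `S` but not `T ∩ S`. Submodularity of the
  -- neighbourhood size is then strict, against the Hall bounds `l1` and `l2`.
  have hdS : d ∈ S := by
    by_contra hdS
    have hjT : j ∈ G.nbrIn I T ∩ G.nbrIn I S := mem_inter.2
      ⟨mem_nbrIn.2 ⟨hj, d, hT.mem, hjd.symm⟩, mem_nbrIn.2 ⟨hj, b, hb, hjb.symm⟩⟩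
    have hjn : j ∉ G.nbrIn I (T ∩ S) := by
      intro hjn
      obtain ⟨-, a, ha, haj⟩ := mem_nbrIn.1 hjn
      rw [mem_inter] at ha
      exact hdS (hT.eq a ha.1 haj.symm ▸ ha.2)
    have := card_lt_card (Finset.ssubset_iff_subset_ne.2 ⟨hin, fun he => hjn (he ▸ hjT)⟩)
    omega
  have hint : G.IsTightAt I U j d (T ∩ S) :=
    { subset := inter_subset_left.trans hT.subset
      mem := mem_inter.2 ⟨hT.mem, hdS⟩
      eq := fun c' hc' => hT.eq c' (mem_inter.1 hc').1
      card := by omega }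
  have hTS : T ⊆ S := by
    have := eq_of_subset_of_card_le inter_subset_left (hTm _ hint)
    exact this ▸ inter_subset_right
  refine lt_of_le_of_ne (card_le_card hTS) fun hcard => ?_
  -- If the sets coincide, erasing `d` loses the neighbour `j`. When `c = d` it also loses `i`,
  -- violating Hall's condition; otherwise a smaller tight set at `i`, `c` remains.
  obtain rfl : T = S := eq_of_subset_of_card_le hTS hcard.ge
  have hjN : j ∈ G.nbrIn I T := mem_nbrIn.2 ⟨hj, d, hT.mem, hjd.symm⟩
  have hiN : i ∈ G.nbrIn I T := mem_nbrIn.2 ⟨hi, c, hS.mem, hic.symm⟩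
  have hsub : G.nbrIn I (T.erase d) ⊆ (G.nbrIn I T).erase j := by
    intro v hv
    refine mem_erase.2 ⟨?_, nbrIn_mono (erase_subset _ _) hv⟩
    rintro rfl
    obtain ⟨-, a, ha, haj⟩ := mem_nbrIn.1 hv
    exact (mem_erase.1 ha).1 (hT.eq a (mem_erase.1 ha).2 haj.symm)
  have c1 := card_le_card hsub
  rw [card_erase_of_mem hjN] at c1
  have c2 := card_erase_of_mem hT.mem
  by_cases hcd : c = d
  · subst hcd
    have hsub' : G.nbrIn I (T.erase c) ⊆ ((G.nbrIn I T).erase j).erase i := by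
      intro v hv
      refine mem_erase.2 ⟨?_, hsub hv⟩
      rintro rfl
      obtain ⟨-, a, ha, haj⟩ := mem_nbrIn.1 hv
      exact (mem_erase.1 ha).1 (hS.eq a (mem_erase.1 ha).2 haj.symm)
    have c3 := card_le_card hsub'
    rw [card_erase_of_mem (mem_erase.2 ⟨hij, hiN⟩), card_erase_of_mem hjN] at c3
    have c4 := low (T.erase c) ((erase_subset _ _).trans hT.subset)
    have c5 := card_pos.2 ⟨j, hjN⟩
    have c6 : 1 ≤ ((G.nbrIn I T).erase j).card := card_pos.2 ⟨i, mem_erase.2 ⟨hij, hiN⟩⟩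
    rw [card_erase_of_mem hjN] at c6
    omega
  · have := hSm (T.erase d)
      { subset := (erase_subset _ _).trans hT.subset
        mem := mem_erase.2 ⟨hcd, hS.mem⟩
        eq := fun c' hc' => hS.eq c' (mem_erase.1 hc').2
        card := by omega }
    have c5 := card_pos.2 ⟨d, hT.mem⟩
    omega

variable [Fintype V]

/-- Leaving out row `i` leaves fewer rows than columns, so some nonzero vector on `S` is killed by
the other rows. Row `i` sees only the entry at `c`, which is nonzero since no nonzero vector with
independent support is killed by all rows. -/
theorem exists_generic_vector_of_isTightAt (h : G.IsCriticalSplit I C) (hU : U ⊆ C)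
    (hUi : G.IndepFinset U) {i c : V} (hi : i ∈ I) (hic : G.Adj i c) {S : Finset V}
    (hS : G.IsTightAt I U i c S) :
    ∃ x : V → GenericField V, x c ≠ 0 ∧ (∀ v ∉ S, x v = 0) ∧
      ∀ j ∈ I, G.genericMatrix.mulVec x j = if j = i then 1 else 0 := by
  have hiN : i ∈ G.nbrIn I S := mem_nbrIn.2 ⟨hi, c, hS.mem, hic.symm⟩
  obtain ⟨x, hx0, hxS, hxR⟩ := G.genericMatrix.exists_ne_zero_support_subset_mulVec_eq_zero
    (S := S) (R := (G.nbrIn I S).erase i) (by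
      have := hS.card
      have := card_pos.2 ⟨i, hiN⟩
      rw [card_erase_of_mem hiN]
      omega)
  have hxI : ∀ j ∈ I, j ≠ i → G.genericMatrix.mulVec x j = 0 := by
    intro j hj hji
    by_cases hjn : j ∈ G.nbrIn I S
    · exact hxR j (mem_erase.2 ⟨hji, hjn⟩)
    · refine Finset.sum_eq_zero fun v _ => ?_
      change G.genericMatrix j v * x v = 0
      by_cases hv : v ∈ S
      · rw [G.genericMatrix_of_not_adj, zero_mul]
        exact fun ha => hjn (mem_nbrIn.2 ⟨hj, v, hv, ha.symm⟩)
      · rw [hxS v hv, mul_zero]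
  have hxi : G.genericMatrix.mulVec x i = G.genericMatrix i c * x c := by
    refine Finset.sum_eq_single (M := GenericField V) c (fun v _ hv => ?_)
      fun hn => absurd (mem_univ c) hn
    change G.genericMatrix i v * x v = 0
    by_cases hvS : v ∈ S
    · rw [G.genericMatrix_of_not_adj fun ha => hv (hS.eq v hvS ha), zero_mul]
    · rw [hxS v hvS, mul_zero]
  have hxc : x c ≠ 0 := by
    intro hxc
    refine hx0 (h.eq_zero_of_support_subset (hS.subset.trans hU) (hUi.mono hS.subset) hxS ?_)
    intro j hj
    by_cases hji : j = i
    · rw [hji, hxi, hxc, mul_zero]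
    · exact hxI j hj hji
  have hne : G.genericMatrix.mulVec x i ≠ 0 := by
    rw [hxi]
    exact mul_ne_zero (G.genericMatrix_ne_zero hic) hxc
  refine ⟨(G.genericMatrix.mulVec x i)⁻¹ • x, ?_, fun v hv => ?_, fun j hj => ?_⟩
  · exact mul_ne_zero (inv_ne_zero hne) hxc
  · rw [Pi.smul_apply, hxS v hv, smul_zero]
  · rw [Matrix.mulVec_smul, Pi.smul_apply, smul_eq_mul]
    split_ifs with hji
    · rw [hji, inv_mul_cancel₀ hne]
    · rw [hxI j hj hji, mul_zero]

/-- Vertices of `I` with three distinct neighbours each, all of which admit tight sets with the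
same three traces. -/
theorem card_le_cube_of_isTightAt (h : G.IsCriticalSplit I C) {ι : Type*} [Fintype ι]
    (v : ι → V) (hv : v.Injective) (hvI : ∀ i, v i ∈ I) (c : Fin 3 → ι → V)
    (hc : ∀ s t, s ≠ t → ∀ i, c s i ≠ c t i) (hadj : ∀ s i, G.Adj (v i) (c s i))
    (U : Fin 3 → Finset V) (hU : ∀ s, U s ⊆ C) (hUi : ∀ s, G.IndepFinset (U s))
    (hT : ∀ s i, ∃ S, G.IsTightAt I (U s) (v i) (c s i) S) :
    Fintype.card ι ≤ Module.finrank (GenericField V) (G.genericKernel I C) ^ 3 := by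
  classical
  have hmin : ∀ s i, ∃ S, G.IsTightAt I (U s) (v i) (c s i) S ∧
      ∀ S', G.IsTightAt I (U s) (v i) (c s i) S' → S.card ≤ S'.card := by
    intro s i
    obtain ⟨S, hS, hSm⟩ := Finset.exists_min_image
      (univ.filter fun S => G.IsTightAt I (U s) (v i) (c s i) S) Finset.card
      (by obtain ⟨S, hS⟩ := hT s i; exact ⟨S, by simpa using hS⟩)
    exact ⟨S, by simpa using hS, fun S' hS' => hSm S' (by simpa using hS')⟩
  choose S hS hSm using hmin
  choose x hxc hxS hxI using fun s i =>
    h.exists_generic_vector_of_isTightAt (hU s) (hUi s) (hvI i) (hadj s i) (hS s i)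
  -- Both vectors are sent to the unit vector at `v i`, so their difference lies in the kernel.
  let y : Fin 3 → Fin 3 → ι → G.genericKernel I C := fun s t i =>
    ⟨x s i - x t i, mem_genericKernel.2 ⟨fun u hu => by
      rw [Pi.sub_apply, hxS s i u fun hn => hu (hU s ((hS s i).subset hn)),
        hxS t i u fun hn => hu (hU t ((hS t i).subset hn)), sub_zero], fun j hj => by
      rw [Matrix.mulVec_sub, Pi.sub_apply, hxI s i j hj, hxI t i j hj, sub_self]⟩⟩
  let φ : Fin 3 → Fin 3 → ι → G.genericKernel I C →ₗ[GenericField V] GenericField V :=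
    fun s _ j => (LinearMap.proj (c s j)) ∘ₗ (G.genericKernel I C).subtype
  have hφ : ∀ s t i j, φ s t j (y s t i) = x s i (c s j) - x t i (c s j) :=
    fun s t i j => rfl
  let N := Fintype.card ι
  let r := Fintype.equivFin ι
  -- Order by the size of the minimum tight set; since `r i < N`, the second summand only breaks
  -- ties.
  let g : Fin 3 → ι → ℕ := fun s i => N * (S s i).card + r i
  have hvan : ∀ s i j, g s i < g s j → ∀ b, G.Adj (v j) b → x s i b = 0 := by
    intro s i j hg b hb
    refine hxS s i b fun hbS => ?_
    have hij : v i ≠ v j := fun he => by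
      rw [hv he] at hg
      exact lt_irrefl _ hg
    have hlt := h.card_lt_card_of_isTightAt (hU s) (hUi s) (hvI i) (hvI j) hij (hadj s i)
      (hadj s j) (hS s i) (hSm s i) (hS s j) (hSm s j) hbS hb
    have h1 : N * ((S s j).card + 1) ≤ N * (S s i).card := Nat.mul_le_mul_left _ hlt
    have h2 : (r j : ℕ) < N := (r j).2
    rw [mul_add] at h1
    simp only [g] at hg
    omega
  refine card_le_cube_of_triangular (F := GenericField V) (univ : Finset ι) g ?_ y φ ?_ ?_
  · intro s i j hij
    have h1 := congrArg (· % N) hij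
    have hr : ∀ i, (r i : ℕ) % N = r i := fun i => Nat.mod_eq_of_lt (r i).2
    simp only [g, Nat.mul_add_mod, hr] at h1
    exact r.injective (Fin.ext h1)
  · intro s t hst j _
    rw [hφ, hxS t j (c s j) fun hn => hc s t hst j ((hS t j).eq _ hn (hadj s j)), sub_zero]
    exact hxc s j
  · intro s t _ i _ j _ hs ht
    rw [hφ, hvan s i j hs _ (hadj s j), hvan t i j ht _ (hadj s j), sub_self]

omit [Fintype V] in
-- The witness is `J ∩ C` for `J` critical for the edge `ic`: its neighbours in `I` avoid `J ∩ I`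
-- except for `i`. Leaving `U` free allows the ambient independent set to be chosen later.
theorem exists_isTightAt (h : G.IsCriticalSplit I C) {i c : V} (hi : i ∈ I) (hic : G.Adj i c) :
    ∃ S ⊆ C, G.IndepFinset S ∧ ∀ U, S ⊆ U → G.IsTightAt I U i c S := by
  have hc := h.mem_right hi hic
  have hiC : i ∉ C := Finset.disjoint_left.1 h.disj hi
  obtain ⟨J, hJ, hJc, hiJ, hcJ, hJe⟩ := h.crit i c hic
  refine ⟨J ∩ C, inter_subset_right, ?_, fun U hSU => ⟨hSU, mem_inter.2 ⟨hcJ, hc⟩, ?_, ?_⟩⟩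
  · intro u hu w hw huw
    rw [mem_inter] at hu hw
    rcases hJe u hu.1 w hw.1 huw with ⟨h1, -⟩ | ⟨-, h2⟩
    · exact hiC (h1 ▸ hu.2)
    · exact hiC (h2 ▸ hw.2)
  · intro b hb hib
    rcases hJe i hiJ b (mem_inter.1 hb).1 hib with ⟨-, h2⟩ | ⟨h1, -⟩
    · exact h2
    · exact absurd (h1 ▸ hc) hiC
  · have hdis : Disjoint ((J ∩ I).erase i) (G.nbrIn I (J ∩ C)) := by
      rw [Finset.disjoint_left]
      intro j hj hj'
      obtain ⟨hjI, s, hs, hsj⟩ := mem_nbrIn.1 hj'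
      rw [mem_erase, mem_inter] at hj
      rcases hJe s (mem_inter.1 hs).1 j hj.2.1 hsj with ⟨h1, -⟩ | ⟨-, h2⟩
      · exact hiC (h1 ▸ (mem_inter.1 hs).2)
      · exact hj.1 h2
    have c1 : ((J ∩ I).erase i).card + (G.nbrIn I (J ∩ C)).card ≤ I.card := by
      rw [← card_union_of_disjoint hdis]
      exact card_le_card (union_subset ((erase_subset _ _).trans inter_subset_right)
        (nbrIn_subset _ _ _))
    have c2 : J.card ≤ (J ∩ I).card + (J ∩ C).card := by
      have : J = (J ∩ I) ∪ (J ∩ C) := by rw [← inter_union_distrib_left, inter_eq_left.2 hJ]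
      rw [this]
      convert card_union_le _ _ using 3 <;> rw [← this]
    have c3 := card_erase_of_mem (mem_inter.2 ⟨hiJ, hi⟩)
    omega

/-- In a critical split whose sides differ in size by `d`, the number of vertices of `I` with at
least three neighbours is bounded in terms of `d`. -/
theorem card_three_neighbours_le (h : G.IsCriticalSplit I C) {Y : Finset V} (hY : Y ⊆ I)
    (hY3 : ∀ i ∈ Y, ∃ c : Fin 3 → V, c.Injective ∧ ∀ s, G.Adj i (c s)) :
    Y.card ≤ (C.card - I.card) ^ 3 * (2 ^ (C.card - I.card) ^ 2) ^ 3 := by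
  classical
  let r := Fintype.equivFin V
  let D : Finset (V × V) := (C ×ˢ C).filter fun e => G.Adj e.1 e.2 ∧ r e.1 < r e.2
  have hDm : ∀ e : V × V, e ∈ D ↔ (e.1 ∈ C ∧ e.2 ∈ C) ∧ G.Adj e.1 e.2 ∧ r e.1 < r e.2 := by
    intro e
    simp [D]
  have hDc : D.card ≤ (C.card - I.card) ^ 2 := by
    refine (h.card_edges_le D (fun e he => ?_) fun e he hs => ?_).trans
      (Nat.pow_le_pow_left h.finrank_genericKernel_le 2)
    · rw [hDm] at he
      exact ⟨he.1.1, he.1.2, he.2.1⟩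
    · rw [hDm] at he hs
      exact lt_asymm he.2.2 hs.2.2
  -- From each edge inside `C` remove one end: the first if the edge is in `τ`, the second
  -- otherwise. An independent `S ⊆ C` lies in `U τ` when `τ` consists of the edges whose first end
  -- is outside `S`.
  let U : Finset (V × V) → Finset V := fun τ =>
    C.filter fun w => ∀ e ∈ D, (e ∈ τ → w ≠ e.1) ∧ (e ∉ τ → w ≠ e.2)
  have hUm : ∀ τ w, w ∈ U τ ↔ w ∈ C ∧ ∀ e ∈ D, (e ∈ τ → w ≠ e.1) ∧ (e ∉ τ → w ≠ e.2) := by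
    intro τ w
    simp [U]
  have hUC : ∀ τ, U τ ⊆ C := fun τ => filter_subset _ _
  have hUi : ∀ τ, G.IndepFinset (U τ) := by
    intro τ
    have key : ∀ u ∈ U τ, ∀ w ∈ U τ, G.Adj u w → r u < r w → False := by
      intro u hu w hw huw hr
      have hD := (hDm (u, w)).2 ⟨⟨hUC τ hu, hUC τ hw⟩, huw, hr⟩
      by_cases hτ : (u, w) ∈ τ
      · exact (((hUm τ u).1 hu).2 _ hD).1 hτ rfl
      · exact (((hUm τ w).1 hw).2 _ hD).2 hτ rfl
    intro u hu w hw huw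
    rcases lt_trichotomy (r u) (r w) with hr | hr | hr
    · exact key u hu w hw huw hr
    · exact G.irrefl (r.injective hr ▸ huw)
    · exact key w hw u hu huw.symm hr
  choose! c hci hca using hY3
  have htr : ∀ i ∈ Y, ∀ s, ∃ τ ∈ D.powerset, ∃ S, G.IsTightAt I (U τ) i (c i s) S := by
    intro i hi s
    obtain ⟨S, hSC, hSi, hS⟩ := h.exists_isTightAt (hY hi) (hca i hi s)
    refine ⟨D.filter fun e => e.1 ∉ S, by simp, S, hS _ fun w hw => (hUm _ w).2 ⟨hSC hw, ?_⟩⟩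
    intro e he
    refine ⟨fun heτ hwe => (mem_filter.1 heτ).2 (hwe ▸ hw), fun heτ hwe => ?_⟩
    have h1 : e.1 ∈ S := by
      by_contra hn
      exact heτ (mem_filter.2 ⟨he, hn⟩)
    exact hSi e.1 h1 e.2 (hwe ▸ hw) ((hDm e).1 he).2.1
  choose! τ hτD hτS using htr
  have hmaps : ∀ i ∈ Y, τ i ∈ Fintype.piFinset fun _ : Fin 3 => D.powerset := fun i hi =>
    Fintype.mem_piFinset.2 fun s => hτD i hi s
  have hfib := Finset.card_le_mul_card_image_of_maps_to hmaps ((C.card - I.card) ^ 3) (by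
    intro σ _
    have h1 := h.card_le_cube_of_isTightAt (ι := (Y.filter fun i => τ i = σ : Finset V))
      Subtype.val Subtype.val_injective (fun i => hY (mem_filter.1 i.2).1) (fun s i => c i.1 s)
      (fun s t hst i he => hst (hci i.1 (mem_filter.1 i.2).1 he))
      (fun s i => hca i.1 (mem_filter.1 i.2).1 s) (fun s => U (σ s)) (fun s => hUC _)
      (fun s => hUi _) (fun s i => by
        have h2 := hτS i.1 (mem_filter.1 i.2).1 s
        rwa [(mem_filter.1 i.2).2] at h2)
    rw [Fintype.card_coe] at h1
    exact h1.trans (Nat.pow_le_pow_left h.finrank_genericKernel_le 3))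
  refine hfib.trans (Nat.mul_le_mul_left _ ?_)
  rw [Fintype.card_piFinset_const, card_powerset]
  exact Nat.pow_le_pow_left (Nat.pow_le_pow_right (by norm_num) hDc) 3

end SimpleGraph.IsCriticalSplit

end Tight

/-! ### Stability on vertex subsets and edge-critical subgraphs -/

section IndepOn

variable {V : Type*} [DecidableEq V]

open Classical in
/-- The largest size of an independent set contained in `A`. -/
noncomputable def SimpleGraph.indepOn (G : SimpleGraph V) (A : Finset V) : ℕ :=
  (A.powerset.filter fun J => G.IndepFinset J).sup card

namespace SimpleGraph

variable {G H : SimpleGraph V} {A B J : Finset V}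

omit [DecidableEq V] in
theorem card_le_indepOn (hJ : J ⊆ A) (hi : G.IndepFinset J) : J.card ≤ G.indepOn A := by
  classical
  exact Finset.le_sup (f := card) (mem_filter.2 ⟨mem_powerset.2 hJ, hi⟩)

omit [DecidableEq V] in
theorem exists_card_eq_indepOn (G : SimpleGraph V) (A : Finset V) :
    ∃ J ⊆ A, G.IndepFinset J ∧ J.card = G.indepOn A := by
  classical
  obtain ⟨J, hJ, hc⟩ := Finset.exists_mem_eq_sup (A.powerset.filter fun J => G.IndepFinset J)
    ⟨∅, mem_filter.2 ⟨empty_mem_powerset _, fun u hu => absurd hu (notMem_empty u)⟩⟩ card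
  rw [mem_filter, mem_powerset] at hJ
  exact ⟨J, hJ.1, hJ.2, hc.symm⟩

omit [DecidableEq V] in
theorem indepOn_mono (hAB : A ⊆ B) : G.indepOn A ≤ G.indepOn B := by
  obtain ⟨J, hJ, hi, hc⟩ := G.exists_card_eq_indepOn A
  exact hc ▸ card_le_indepOn (hJ.trans hAB) hi

omit [DecidableEq V] in
theorem indepOn_anti (hHG : H ≤ G) : G.indepOn A ≤ H.indepOn A := by
  obtain ⟨J, hJ, hi, hc⟩ := G.exists_card_eq_indepOn A
  exact hc ▸ card_le_indepOn hJ fun u hu v hv huv => hi u hu v hv (hHG huv)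

omit [DecidableEq V] in
theorem indepNum_induce_eq_indepOn [Fintype V] (G : SimpleGraph V) (s : Set V) (A : Finset V)
    (hA : ∀ v, v ∈ A ↔ v ∈ s) : (G.induce s).indepNum = G.indepOn A := by
  classical
  apply le_antisymm
  · obtain ⟨J, hJ⟩ := (G.induce s).exists_isNIndepSet_indepNum
    rw [← hJ.card_eq, ← card_map (Function.Embedding.subtype (· ∈ s))]
    refine card_le_indepOn (fun v hv => ?_) fun u hu v hv huv => ?_
    · obtain ⟨w, -, rfl⟩ := mem_map.1 hv
      exact (hA _).2 w.2
    · obtain ⟨a, ha, rfl⟩ := mem_map.1 hu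
      obtain ⟨b, hb, rfl⟩ := mem_map.1 hv
      exact hJ.isIndepSet ha hb (fun he => G.irrefl (he ▸ huv)) huv
  · obtain ⟨J, hJ, hi, hc⟩ := G.exists_card_eq_indepOn A
    have h1 : (J.subtype (· ∈ s)).card = J.card := by
      rw [card_subtype, filter_true_of_mem fun v hv => (hA v).1 (hJ hv)]
    rw [← hc, ← h1]
    exact IsIndepSet.card_le_indepNum fun u hu v hv _ =>
      hi u (mem_subtype.1 hu) v (mem_subtype.1 hv)

omit [DecidableEq V] in
theorem indepNum_eq_indepOn [Fintype V] (G : SimpleGraph V) :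
    G.indepNum = G.indepOn univ := by
  apply le_antisymm
  · obtain ⟨J, hJ⟩ := G.exists_isNIndepSet_indepNum
    rw [← hJ.card_eq]
    exact card_le_indepOn (subset_univ _) fun u hu v hv huv =>
      hJ.isIndepSet hu hv (fun he => G.irrefl (he ▸ huv)) huv
  · obtain ⟨J, -, hi, hc⟩ := G.exists_card_eq_indepOn univ
    rw [← hc]
    exact IsIndepSet.card_le_indepNum fun u hu v hv _ => hi u hu v hv

/-- Deleting any `k` vertices from `A` lowers the independence number by at most `ℓ`. -/
def IsStableOn (G : SimpleGraph V) (A : Finset V) (k ℓ : ℕ) : Prop :=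
  ∀ S ⊆ A, S.card = k → G.indepOn A ≤ G.indepOn (A \ S) + ℓ

/-- Adjoin `v` to the deleted set. The case `m = 0` serves vertices whose deletion is free, and `m =
1` isolated vertices. -/
theorem IsStableOn.erase {k ℓ m : ℕ} {v : V} (h : G.IsStableOn A (k + 1) (ℓ + m)) (hv : v ∈ A)
    (hm : G.indepOn (A.erase v) + m ≤ G.indepOn A) : G.IsStableOn (A.erase v) k ℓ := by
  intro S hS hSc
  have hvS : v ∉ S := fun hn => (mem_erase.1 (hS hn)).1 rfl
  have h1 := h (insert v S) (insert_subset hv (hS.trans (erase_subset _ _)))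
    (by rw [card_insert_of_notMem hvS, hSc])
  rw [sdiff_insert, ← erase_sdiff_comm] at h1
  omega

/-- In a `(3ℓ + 3, ℓ)`-stable graph, an independent set of vertices with at most two neighbours
each has at most `ℓ` elements. -/
theorem IsStableOn.card_le_of_degree_le_two {ℓ : ℕ} (h : G.IsStableOn A (3 * ℓ + 3) ℓ)
    (hA : 3 * ℓ + 3 ≤ A.card) {Q : Finset V} (hQ : Q ⊆ A) (hQi : G.IndepFinset Q)
    (hdeg : ∀ v ∈ Q, ∃ N : Finset V, N.card ≤ 2 ∧ ∀ w, G.Adj v w → w ∈ N) : Q.card ≤ ℓ := by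
  by_contra! hlt
  obtain ⟨P, hPQ, hPc⟩ := exists_subset_card_eq (show ℓ + 1 ≤ Q.card from hlt)
  choose! N hN hNa using hdeg
  let S₀ := (P.biUnion fun v => insert v (N v)) ∩ A
  have hS₀c : S₀.card ≤ 3 * ℓ + 3 := by
    refine (card_le_card inter_subset_left).trans ?_
    refine (card_biUnion_le_card_mul P _ 3 fun v hv => ?_).trans (by omega)
    exact (card_insert_le _ _).trans (Nat.succ_le_succ (hN v (hPQ hv)))
  obtain ⟨S, hS₀S, hSA, hSc⟩ := exists_subsuperset_card_eq inter_subset_right hS₀c hA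
  have h1 := h S hSA hSc
  obtain ⟨J, hJ, hJi, hJc⟩ := G.exists_card_eq_indepOn (A \ S)
  have hin : ∀ v ∈ P, ∀ w ∈ insert v (N v), w ∈ A → w ∉ J := fun v hv w hw hwA hwJ =>
    (mem_sdiff.1 (hJ hwJ)).2 (hS₀S (mem_inter.2 ⟨mem_biUnion.2 ⟨v, hv, hw⟩, hwA⟩))
  have hJA : J ⊆ A := hJ.trans sdiff_subset
  have hdis : Disjoint P J := Finset.disjoint_left.2 fun v hv =>
    hin v hv v (mem_insert_self _ _) (hQ (hPQ hv))
  have hPJ : ∀ v ∈ P, ∀ w ∈ J, ¬ G.Adj v w := fun v hv w hw hvw =>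
    hin v hv w (mem_insert_of_mem (hNa v (hPQ hv) w hvw)) (hJA hw) hw
  have h2 := card_le_indepOn (G := G) (A := A) (J := P ∪ J)
    (union_subset (hPQ.trans hQ) hJA) (by
      intro u hu v hv huv
      rcases mem_union.1 hu with hu | hu <;> rcases mem_union.1 hv with hv | hv
      · exact hQi u (hPQ hu) v (hPQ hv) huv
      · exact hPJ u hu v hv huv
      · exact hPJ v hv u hu huv.symm
      · exact hJi u hu v hv huv)
  rw [card_union_of_disjoint hdis] at h2
  omega

/-- Some spanning subgraph has the same independence number on `A`, and each of its edges is
critical for it. -/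
theorem exists_critical_subgraph [Finite V] (G : SimpleGraph V) (A : Finset V) :
    ∃ H ≤ G, H.indepOn A = G.indepOn A ∧ ∀ u v, H.Adj u v →
      ∃ J ⊆ A, J.card = H.indepOn A + 1 ∧ u ∈ J ∧ v ∈ J ∧
        ∀ x ∈ J, ∀ y ∈ J, H.Adj x y → (x = u ∧ y = v) ∨ (x = v ∧ y = u) := by
  obtain ⟨H, ⟨hHG, hHA⟩, hmin⟩ := (Set.toFinite {H : SimpleGraph V | H ≤ G ∧
    H.indepOn A = G.indepOn A}).exists_minimal ⟨G, le_rfl, rfl⟩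
  refine ⟨H, hHG, hHA, fun u v huv => ?_⟩
  let H' := H.deleteEdges {s(u, v)}
  have hle : H' ≤ H := deleteEdges_le _
  have hne : H'.indepOn A ≠ G.indepOn A := fun he => by
    have h1 := hmin ⟨hle.trans hHG, he⟩ hle huv
    simp [H', deleteEdges_adj] at h1
  have hlt : H.indepOn A < H'.indepOn A :=
    lt_of_le_of_ne (indepOn_anti hle) (by rw [hHA]; exact hne.symm)
  obtain ⟨J, hJ, hJi, hJc⟩ := H'.exists_card_eq_indepOn A
  have hadj : ∀ {T : Finset V}, T ⊆ J → ∀ x ∈ T, ∀ y ∈ T, H.Adj x y →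
      (x = u ∧ y = v) ∨ (x = v ∧ y = u) := by
    intro T hT x hx y hy hxy
    by_contra hcon
    refine hJi x (hT hx) y (hT hy) (deleteEdges_adj.2 ⟨hxy, fun hm => hcon ?_⟩)
    simpa using hm
  have hmem : ∀ {T : Finset V}, T ⊆ J → H.indepOn A < T.card → u ∈ T ∧ v ∈ T := by
    intro T hT hTc
    by_contra hcon
    refine hTc.not_ge (card_le_indepOn (hT.trans hJ) fun x hx y hy hxy => hcon ?_)
    rcases hadj hT x hx y hy hxy with ⟨rfl, rfl⟩ | ⟨rfl, rfl⟩
    · exact ⟨hx, hy⟩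
    · exact ⟨hy, hx⟩
  -- Trimming `J` to size exactly `α + 1` is safe: by `hmem`, any subset larger than `α` keeps both
  -- ends of the edge.
  obtain ⟨T, hTJ, hTc⟩ := exists_subset_card_eq
    (show H.indepOn A + 1 ≤ J.card by omega)
  obtain ⟨huT, hvT⟩ := hmem hTJ (by omega)
  exact ⟨T, hTJ.trans hJ, hTc, huT, hvT, hadj hTJ⟩

end SimpleGraph

end IndepOn

/-- The left side bounds `2|I| + d`, the number of vertices. Passing from `ℓ + 3` to `ℓ + 4` in the
exponent leaves a spare factor of at least 4, which absorbs the doubling and the linear terms. -/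
theorem two_mul_add_le_two_pow {ℓ d : ℕ} (hd : d ≤ ℓ + 3) :
    2 * (ℓ + d ^ 3 * (2 ^ d ^ 2) ^ 3) + d ≤ 2 ^ (3 * (ℓ + 4) ^ 2) := by
  have h1 : d ^ 3 ≤ 2 ^ (3 * (ℓ + 3)) := by
    rw [mul_comm, pow_mul]
    exact Nat.pow_le_pow_left (hd.trans Nat.lt_two_pow_self.le) 3
  have h2 : (2 ^ d ^ 2) ^ 3 ≤ 2 ^ (3 * (ℓ + 3) ^ 2) := by
    rw [← pow_mul, mul_comm]
    exact Nat.pow_le_pow_right (by norm_num) (Nat.mul_le_mul_left _ (Nat.pow_le_pow_left hd 2))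
  have h3 : d ^ 3 * (2 ^ d ^ 2) ^ 3 ≤ 2 ^ (3 * (ℓ + 3) + 3 * (ℓ + 3) ^ 2) := by
    rw [pow_add]
    exact Nat.mul_le_mul h1 h2
  have h4 : 3 * (ℓ + 3) ≤ 2 ^ (3 * (ℓ + 3) + 3 * (ℓ + 3) ^ 2) :=
    Nat.lt_two_pow_self.le.trans (Nat.pow_le_pow_right (by norm_num) (Nat.le_add_right _ _))
  have h5 : 2 ^ (3 * (ℓ + 3) + 3 * (ℓ + 3) ^ 2 + 2) ≤ 2 ^ (3 * (ℓ + 4) ^ 2) :=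
    Nat.pow_le_pow_right (by norm_num) (by nlinarith)
  rw [pow_add] at h5
  omega

theorem three_mul_add_le_two_pow (ℓ : ℕ) : 3 * ℓ + 3 ≤ 2 ^ (3 * (ℓ + 4) ^ 2) :=
  Nat.lt_two_pow_self.le.trans (Nat.pow_le_pow_right (by norm_num) (by nlinarith))

/-! ### Reduction to the critical case and the final bound -/

section Main

variable {V : Type*} [DecidableEq V] [Fintype V]

namespace SimpleGraph

/-- The order of a tight `(3ℓ + 3, ℓ)`-stable graph with critical edges and no isolated vertices
is bounded in terms of `ℓ`. -/
theorem IsStableOn.card_le_of_critical {G : SimpleGraph V} {A : Finset V} {ℓ : ℕ}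
    (h : G.IsStableOn A (3 * ℓ + 3) ℓ) (hA : 3 * ℓ + 3 ≤ A.card)
    (hα : A.card ≤ 2 * G.indepOn A + ℓ + 3)
    (hcrit : ∀ u v, G.Adj u v → ∃ J ⊆ A, J.card = G.indepOn A + 1 ∧ u ∈ J ∧ v ∈ J ∧
      ∀ x ∈ J, ∀ y ∈ J, G.Adj x y → (x = u ∧ y = v) ∨ (x = v ∧ y = u))
    (hiso : ∀ v ∈ A, ∃ w, G.Adj v w) : A.card ≤ 2 ^ (3 * (ℓ + 4) ^ 2) := by
  classical
  obtain ⟨I, hIA, hIi, hIc⟩ := G.exists_card_eq_indepOn A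
  have hun : I ∪ (A \ I) = A := union_sdiff_of_subset hIA
  have hs : G.IsCriticalSplit I (A \ I) :=
    { disj := disjoint_sdiff
      indep := hIi
      mem := fun u v huv => by
        obtain ⟨J, hJ, -, hu, -⟩ := hcrit u v huv
        exact hun.symm ▸ hJ hu
      max := fun J hJ hJi => by
        rw [hun] at hJ
        exact hIc ▸ card_le_indepOn hJ hJi
      nbr := fun i hi => hiso i (hIA hi)
      crit := fun u v huv => by
        rw [hun, hIc]
        exact hcrit u v huv }
  -- This gives `|I| ≤ |A \ I|`, so the truncated difference used as `d` is exact.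
  have hle := hs.card_le_card_nbrIn_left (Subset.refl I)
  have hle' := card_le_card (nbrIn_subset G (A \ I) I)
  have hC := card_sdiff_add_card_eq_card hIA
  let Y := I.filter fun i => 3 ≤ G.degree i
  have hY := hs.card_three_neighbours_le (Y := Y) (filter_subset _ _) (by
    intro i hi
    have h3 : Fintype.card (Fin 3) ≤ (G.neighborFinset i).card := by
      simpa using (mem_filter.1 hi).2
    obtain ⟨T, hT, hTc⟩ := exists_subset_card_eq h3
    let e := T.equivFinOfCardEq (by simpa using hTc)
    exact ⟨fun s => (e.symm s).1, Subtype.val_injective.comp e.symm.injective,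
      fun s => (G.mem_neighborFinset _ _).1 (hT (e.symm s).2)⟩)
  have hQ := h.card_le_of_degree_le_two hA (Q := I \ Y) (sdiff_subset.trans hIA)
    (hIi.mono sdiff_subset) (fun v hv => ⟨G.neighborFinset v, by
      rw [mem_sdiff] at hv
      have h2 : ¬ 3 ≤ G.degree v := fun h3 => hv.2 (mem_filter.2 ⟨hv.1, h3⟩)
      rw [card_neighborFinset_eq_degree]
      omega, fun w hw => (G.mem_neighborFinset _ _).2 hw⟩)
  have hI := card_sdiff_add_card_eq_card (s := Y) (t := I) (filter_subset _ _)
  have harith := two_mul_add_le_two_pow (ℓ := ℓ) (d := (A \ I).card - I.card) (by omega)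
  omega

theorem IsStableOn.card_le_of_tight {A : Finset V} {G : SimpleGraph V} {k ℓ : ℕ}
    (hk : 3 * ℓ + 3 ≤ k) (h : G.IsStableOn A k ℓ)
    (hα : (G.indepOn A : ℤ) = ((A.card : ℤ) - k + 1) / 2 + ℓ) :
    A.card + 3 * ℓ + 3 ≤ k + 2 ^ (3 * (ℓ + 4) ^ 2) := by
  induction A using Finset.strongInduction generalizing G k ℓ with
  | H A ih =>
    have hpow := three_mul_add_le_two_pow ℓ
    rcases lt_or_ge A.card k with hAk | hAk
    · omega
    rcases hk.eq_or_lt with rfl | hk'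
    -- Removing edges keeps `α` on `A` and can only raise it on `A \ S`, so stability and tightness
    -- pass to `H`.
    · obtain ⟨H, hHG, hHA, hcrit⟩ := G.exists_critical_subgraph A
      have hH : H.IsStableOn A (3 * ℓ + 3) ℓ := fun S hS hSc => by
        have h1 := h S hS hSc
        have h2 := indepOn_anti (A := A \ S) hHG
        omega
      by_cases hiso : ∀ v ∈ A, ∃ w, H.Adj v w
      · have h1 := hH.card_le_of_critical hAk (by omega) hcrit hiso
        omega
      · push Not at hiso
        obtain ⟨v, hv, hvw⟩ := hiso
        have hver : H.indepOn (A.erase v) + 1 = H.indepOn A := by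
          apply le_antisymm
          · obtain ⟨J, hJ, hJi, hJc⟩ := H.exists_card_eq_indepOn (A.erase v)
            have hvJ : v ∉ J := fun hn => (mem_erase.1 (hJ hn)).1 rfl
            rw [← hJc, ← card_insert_of_notMem hvJ]
            refine card_le_indepOn (insert_subset hv (hJ.trans (erase_subset _ _))) ?_
            intro x hx y hy hxy
            rcases mem_insert.1 hx with rfl | hx
            · exact hvw y hxy
            rcases mem_insert.1 hy with rfl | hy
            · exact hvw x hxy.symm
            exact hJi x hx y hy hxy
          · obtain ⟨J, hJ, hJi, hJc⟩ := H.exists_card_eq_indepOn A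
            have h1 := card_le_indepOn (G := H) (erase_subset_erase v hJ)
              (hJi.mono (erase_subset _ _))
            have h2 := pred_card_le_card_erase (s := J) (a := v)
            omega
        -- For `ℓ = 0` an isolated vertex is impossible: deleting three vertices including it lowers
        -- `α`.
        rcases ℓ with _ | ℓ
        · obtain ⟨S, hvS, hSA, hSc⟩ := exists_subsuperset_card_eq
            (singleton_subset_iff.2 hv) (by simp : ({v} : Finset V).card ≤ 3 * 0 + 3) hAk
          have h1 := hH S hSA hSc
          have h2 := indepOn_mono (G := H) (A := A \ S) (B := A.erase v)
            (fun w hw => mem_erase.2 ⟨fun he => (mem_sdiff.1 hw).2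
              (hvS (mem_singleton.2 he)), (mem_sdiff.1 hw).1⟩)
          omega
        · have hc := card_erase_of_mem hv
          have hc' := card_pos.2 ⟨v, hv⟩
          -- Here `3(ℓ + 1) + 3 - 1 = 3ℓ + 5` is two above the threshold for the smaller `ℓ`; the
          -- growth of the exponential term absorbs this excess.
          have h1 := ih (A.erase v) (erase_ssubset hv) (G := H) (k := 3 * ℓ + 5) (ℓ := ℓ)
            (by omega) (IsStableOn.erase (m := 1) hH hv hver.le) (by push_cast at hα ⊢; omega)
          have h2 : 2 ^ (3 * (ℓ + 4) ^ 2 + 2) ≤ 2 ^ (3 * (ℓ + 1 + 4) ^ 2) :=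
            Nat.pow_le_pow_right (by norm_num) (by nlinarith)
          have h3 : 1 ≤ 2 ^ (3 * (ℓ + 4) ^ 2) := Nat.one_le_two_pow
          rw [pow_add] at h2
          omega
    · obtain ⟨k, rfl⟩ : ∃ k', k = k' + 1 := ⟨k - 1, by omega⟩
      -- A free deletion lowers `|A|` and `k` together, preserving tightness. If there is none, a
      -- maximum independent set is all of `A`, which is too large for tightness.
      by_cases hv : ∃ v ∈ A, G.indepOn (A.erase v) = G.indepOn A
      · obtain ⟨v, hv, hver⟩ := hv
        have hc := card_erase_of_mem hv
        have hc' := card_pos.2 ⟨v, hv⟩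
        have h1 := ih (A.erase v) (erase_ssubset hv) (G := G) (k := k) (ℓ := ℓ) (by omega)
          (IsStableOn.erase (m := 0) h hv (by omega)) (by push_cast at hα; omega)
        omega
      · obtain ⟨J, hJ, hJi, hJc⟩ := G.exists_card_eq_indepOn A
        have hJA : A ⊆ J := fun v hvA => by
          by_contra hvJ
          refine hv ⟨v, hvA, le_antisymm (indepOn_mono (erase_subset _ _)) ?_⟩
          rw [← hJc]
          exact card_le_indepOn
            (fun w hw => mem_erase.2 ⟨fun he => hvJ (he ▸ hw), hJ hw⟩) hJi
        have h1 := card_le_card hJA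
        push_cast at hα
        omega

end SimpleGraph

theorem SimpleGraph.IsTightStable.card_le {V : Type*} [Fintype V] {G : SimpleGraph V} {k ℓ : ℕ}
    (h : G.IsTightStable k ℓ) (hk : 3 * ℓ + 3 ≤ k) :
    Fintype.card V + 3 * ℓ + 3 ≤ k + 2 ^ (3 * (ℓ + 4) ^ 2) := by
  classical
  obtain ⟨hst, hα⟩ := h
  rw [indepNum_eq_indepOn] at hα
  refine IsStableOn.card_le_of_tight (G := G) (A := univ) hk (fun S _ hSc => ?_) hα
  have h1 := hst S hSc
  rw [indepNum_eq_indepOn, G.indepNum_induce_eq_indepOn _ (univ \ S) (by simp)] at h1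
  omega

end Main

theorem corollary1p7 {V : Type*} [Fintype V] (G : SimpleGraph V) :
    (∀ k ℓ : ℕ, 3 * ℓ + 3 ≤ k → G.IsTightStable k ℓ →
      (Fintype.card V : ℤ) ≤ ((k : ℤ) - 3 * (ℓ : ℤ) - 3) + 2 ^ (3 * (ℓ + 4) ^ 2)) ∧
    (∀ k : ℕ, 6 ≤ k → G.IsTightStable k 1 →
      (Fintype.card V : ℤ) ≤ (k : ℤ) - 6 + 2 ^ 75) := by
  have key : ∀ k ℓ : ℕ, 3 * ℓ + 3 ≤ k → G.IsTightStable k ℓ →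
      (Fintype.card V : ℤ) ≤ ((k : ℤ) - 3 * (ℓ : ℤ) - 3) + 2 ^ (3 * (ℓ + 4) ^ 2) := by
    intro k ℓ hk h
    have h1 : ((Fintype.card V + 3 * ℓ + 3 : ℕ) : ℤ) ≤ ((k + 2 ^ (3 * (ℓ + 4) ^ 2) : ℕ) : ℤ) :=
      Int.ofNat_le.2 (h.card_le hk)
    push_cast at h1
    linarith
  refine ⟨key, fun k hk h => ?_⟩
  have h1 := key k 1 hk h
  norm_num at h1 ⊢
  linarith
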